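/- Theorem. A \emph{picture} over a finite alphabet $A$ is a map $p:\{0,\dots,m-1\}\times\{0,\dots,n-1\}\to A$ with $m,n\ge 1$; its shape is $(m,n)$ (width, height). Its padded version $\hat p$ on $\{0,\dots,m+1\}\times\{0,\dots,n+1\}$ is $p$ translated by $(1,1)$ and surrounded by a frame of symbols $\#\notin A$. A \emph{domino language} over $A$ is the set of all pictures $p$ over $A$ such that no horizontal or vertical domino from a given set of forbidden dominoes over $A\cup\{\#\}$ occurs in $\hat p$. A picture language is \emph{recognizable} if it is the image of a domino language over some finite alphabet under a symbolwise projection. A set $N\subseteq\mathbb{Z}_+^2$ is recognizable if the language of all pictures over a one-letter alphabet with shape in $N$ is recognizable. For a set $X\subseteq A^{\mathbb{Z}^2}$ of configurations over a finite alphabet $A$, an $n\times n$ pattern is \emph{globally valid} if it occurs in some $x\in X$. Let $B_H(n)\in\mathbb{N}\cup\{\infty\}$ be the smallest $k\in\mathbb{N}$ such that for all globally valid $n\times n$ patterns $p,q$ some $x\in X$ contains $p$ with lower left corner at $(0,0)$ and $q$ with lower left corner at $(n+k,0)$ (so the gap between the two blocks is exactly $k$ columns), and $B_H(n)=\infty$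 if there is no such $k$. Let $B_V$ be defined in the same way with $(0,n+k)$ in place of $(n+k,0)$, and let $B(n)=\max(B_H(n),B_V(n))$. The set $X$ is a \emph{shift of finite type} (SFT) if it is the set of all configurations in which no translate of a pattern from some finite set of finite patterns occurs. Write $u\approx v$ if $u(n)/v(n)\to 1$ as $n\to\infty$. Let $f:\mathbb{Z}_+\to\mathbb{Z}_+$ be a nondecreasing function whose epigraph $\{(m,n)\in\mathbb{Z}_+^2 : n\ge f(m)\}$ is recognizable. Then there is a $\mathbb{Z}^2$ SFT over a finite alphabet whose block gluing functions satisfy $$B(n)\approx B_V(n)\approx B_H(n)\approx f(n).$$ -/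

import Mathlib

open SymbolicDynamics.FullShift
open scoped ENNReal

/-! ### Picture languages -/

/-- A (nonempty) picture over `A`: a map `⟦width⟧ × ⟦height⟧ → A` with `width, height ≥ 1`.
The first coordinate is horizontal, the second one is vertical and increases upward. -/
structure Picture (A : Type) where
  width : ℕ+
  height : ℕ+
  cell : Fin (width : ℕ) → Fin (height : ℕ) → A

/-- The padded picture, with `none` in the role of the symbol `#`. It is meant on the domain
`⟦width + 2⟧ × ⟦height + 2⟧`: the picture, shifted by `(1, 1)`, surrounded by a frame of `#`s. -/
def Picture.padded {A : Type} (p : Picture A) (i j : ℕ) : Option A :=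
  if h : (1 ≤ i ∧ i - 1 < (p.width : ℕ)) ∧ (1 ≤ j ∧ j - 1 < (p.height : ℕ)) then
    some (p.cell ⟨i - 1, h.1.2⟩ ⟨j - 1, h.2.2⟩)
  else none

/-- Symbolwise projection of a picture. -/
def Picture.map {A C : Type} (π : C → A) (p : Picture C) : Picture A where
  width := p.width
  height := p.height
  cell i j := π (p.cell i j)

/-- The picture language over `A` given by forbidden horizontal dominoes `H`
(left cell, right cell) and forbidden vertical dominoes `V` (lower cell, upper cell). -/
def dominoLanguage {A : Type} (H V : Set (Option A × Option A)) : Set (Picture A) :=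
  {p | (∀ i j : ℕ, i + 1 < (p.width : ℕ) + 2 → j < (p.height : ℕ) + 2 →
          (p.padded i j, p.padded (i + 1) j) ∉ H) ∧
       (∀ i j : ℕ, i < (p.width : ℕ) + 2 → j + 1 < (p.height : ℕ) + 2 →
          (p.padded i j, p.padded i (j + 1)) ∉ V)}

/-- A picture language is recognizable if it is a symbolwise projection of a domino language
over some finite alphabet. -/
def IsRecognizable {A : Type} (L : Set (Picture A)) : Prop :=
  ∃ (C : Type) (_ : Finite C) (H V : Set (Option C × Option C)) (π : C → A),
    L = Picture.map π '' dominoLanguage H V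

/-- The unique picture of shape `(m, n)` over a one-letter alphabet. -/
def una (m n : ℕ+) : Picture Unit where
  width := m
  height := n
  cell _ _ := ()

/-- A set of shapes is recognizable if the corresponding unary picture language is. -/
def IsRecognizableShapeSet (N : Set (ℕ+ × ℕ+)) : Prop :=
  IsRecognizable ((fun s : ℕ+ × ℕ+ => una s.1 s.2) '' N)

/-- The epigraph `{(m, n) | n ≥ f m}` of `f`. -/
def epigraph (f : ℕ+ → ℕ+) : Set (ℕ+ × ℕ+) :=
  {s | f s.1 ≤ s.2}

/-! ### Subshifts of finite type and block gluing functions -/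

section Gluing

variable {A : Type} [Fintype A] [Inhabited A]

/-- `X` is a `ℤ²` shift of finite type: the set of configurations in which no pattern from some
finite set of finite patterns occurs. -/
def IsSFT (X : Set (ℤ × ℤ → A)) : Prop :=
  ∃ F : Set (Pattern A (ℤ × ℤ)), F.Finite ∧ X = forbidden F

/-- The square `⟦n⟧ × ⟦n⟧`. -/
noncomputable def square (n : ℕ) : Finset (ℤ × ℤ) :=
  Finset.Ico (0 : ℤ) n ×ˢ Finset.Ico (0 : ℤ) n

/-- Any two globally valid `n × n` patterns `p`, `q` occur together in a configuration of `X`,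
with the lower left corner of `q` displaced by `v` from that of `p`. -/
def GluesAt (X : Set (ℤ × ℤ → A)) (n : ℕ) (v : ℤ × ℤ) : Prop :=
  ∀ p ∈ LanguageOn X (square n), ∀ q ∈ LanguageOn X (square n),
    ∃ x ∈ X, p.occursInAt x 0 ∧ q.occursInAt x v

/-- The horizontal block gluing function: the least `k` such that any two globally valid
`n × n` patterns can be glued into a globally valid `(2n + k) × n` pattern; `⊤` if none exists. -/
noncomputable def blockGluingH (X : Set (ℤ × ℤ → A)) (n : ℕ) : ℕ∞ :=
  ⨅ (k : ℕ) (_ : GluesAt X n ((n : ℤ) + k, 0)), (k : ℕ∞)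

/-- The vertical block gluing function. -/
noncomputable def blockGluingV (X : Set (ℤ × ℤ → A)) (n : ℕ) : ℕ∞ :=
  ⨅ (k : ℕ) (_ : GluesAt X n (0, (n : ℤ) + k)), (k : ℕ∞)

/-- The block gluing function. -/
noncomputable def blockGluing (X : Set (ℤ × ℤ → A)) (n : ℕ) : ℕ∞ :=
  max (blockGluingH X n) (blockGluingV X n)

end Gluing

/-- `u ≈ v`: the ratio `u n / v n` tends to `1` as `n → ∞`, in `[0, ∞]`. -/
def AsympEq (u v : ℕ+ → ℕ∞) : Prop :=
  Filter.Tendsto (fun n => (u n : ℝ≥0∞) / (v n : ℝ≥0∞)) Filter.atTop (nhds 1)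

/-! If `f` is bounded, it is eventually a constant `c`, and the hard-core shift, whose block gluing
functions are exactly `c`, does the job. Otherwise `f` tends to infinity, and by
`asympEq_of_bounded_distance` it is enough to find an SFT whose gluing functions differ from `f` by
at most 2.

Let `H`, `V` be forbidden dominoes whose pictures have exactly the shapes in the epigraph. Cut the
plane into (possibly infinite) rectangles whose sides are firm or faulty. Cells carry symbols
obeying the domino rules, except that cells on a faulty edge are exempt. Inside a rectangle a new
picture may be begun at any row, abandoning the one below. A firm base must begin one, and a firm
top must complete one. Faults are free on the left, right and bottom, but a faulty top needs a side
that is not firm. All of this is local.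

Upper bound (`IsFraming.exists_closed`): around an `n × n` window, cut rectangles get faults on the
left, right and bottom. At the top, a rectangle with a faulty side ends after one more row. One with
two firm sides lies within the window's columns, so its width `w` is at most `n`, and a fresh
picture of height `f w ≤ f n` completes it. Two closed windows then fit together at gap `f n + 2`.

Lower bound (`exists_isTiled_of_gluesAt`): above a firm base of width `n` with firm sides there can
be no fault, so the rectangle cannot end before a picture of width `n` is complete, which takes at
least `f n` rows.

This obstructs vertical gluing only; pairing a framing with a transposed one (`symmetricFraming`)
gives the horizontal bound too. -/

/-! ### Domino languages in terms of functions on `ℕ × ℕ` -/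

/-- The values of `q` on `⟦w⟧ × ⟦h⟧`, surrounded by a frame, contain no forbidden domino. -/
structure IsTiled {C : Type} (H V : Set (Option C × Option C)) (w h : ℕ) (q : ℕ → ℕ → C) :
    Prop where
  left : ∀ j < h, (none, some (q 0 j)) ∉ H
  right : ∀ i j, i + 1 = w → j < h → (some (q i j), none) ∉ H
  row : ∀ i j, i + 1 < w → j < h → (some (q i j), some (q (i + 1) j)) ∉ H
  bottom : ∀ i < w, (none, some (q i 0)) ∉ V
  top : ∀ i j, i < w → j + 1 = h → (some (q i j), none) ∉ V
  col : ∀ i j, i < w → j + 1 < h → (some (q i j), some (q i (j + 1))) ∉ V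

theorem Picture.padded_succ {C : Type} (p : Picture C) {i j : ℕ} (hi : i < p.width)
    (hj : j < p.height) : p.padded (i + 1) (j + 1) = some (p.cell ⟨i, hi⟩ ⟨j, hj⟩) := by
  simp [Picture.padded, hi, hj]

theorem Picture.padded_eq_none {C : Type} (p : Picture C) {i j : ℕ}
    (h : i = 0 ∨ j = 0 ∨ (p.width : ℕ) < i ∨ (p.height : ℕ) < j) : p.padded i j = none := by
  unfold Picture.padded
  rw [dif_neg]
  omega

theorem exists_isTiled_of_mem_dominoLanguage {C : Type} {H V : Set (Option C × Option C)}
    {p : Picture C} (hp : p ∈ dominoLanguage H V) :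
    ∃ q, IsTiled H V p.width p.height q := by
  obtain ⟨hH, hV⟩ := hp
  have hw := p.width.pos
  have hh := p.height.pos
  -- Values outside the picture are arbitrary: `IsTiled` never inspects them.
  refine ⟨fun i j => if h : i < p.width ∧ j < p.height then p.cell ⟨i, h.1⟩ ⟨j, h.2⟩
    else p.cell ⟨0, hw⟩ ⟨0, hh⟩, ?_, ?_, ?_, ?_, ?_, ?_⟩
  · intro j hj
    have := hH 0 (j + 1) (by omega) (by omega)
    rw [p.padded_eq_none (by omega), p.padded_succ hw hj] at this
    simpa [hj] using this
  · intro i j hi hj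
    have := hH (i + 1) (j + 1) (by omega) (by omega)
    rw [p.padded_succ (by omega) hj, p.padded_eq_none (by omega)] at this
    simpa [hj, show i < p.width by omega] using this
  · intro i j hi hj
    have := hH (i + 1) (j + 1) (by omega) (by omega)
    rw [p.padded_succ (by omega) hj, p.padded_succ (by omega) hj] at this
    simpa [hj, hi, show i < p.width by omega] using this
  · intro i hi
    have := hV (i + 1) 0 (by omega) (by omega)
    rw [p.padded_eq_none (by omega), p.padded_succ hi hh] at this
    simpa [hi] using this
  · intro i j hi hj
    have := hV (i + 1) (j + 1) (by omega) (by omega)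
    rw [p.padded_succ hi (by omega), p.padded_eq_none (by omega)] at this
    simpa [hi, show j < p.height by omega] using this
  · intro i j hi hj
    have := hV (i + 1) (j + 1) (by omega) (by omega)
    rw [p.padded_succ hi (by omega), p.padded_succ hi (by omega)] at this
    simpa [hi, hj, show j < p.height by omega] using this

theorem IsTiled.mem_dominoLanguage {C : Type} {H V : Set (Option C × Option C)}
    (hH : (none, none) ∉ H) (hV : (none, none) ∉ V) {w h : ℕ+} {q : ℕ → ℕ → C}
    (hq : IsTiled H V w h q) :
    (⟨w, h, fun i j => q i j⟩ : Picture C) ∈ dominoLanguage H V := by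
  have hw := w.pos
  have hh := h.pos
  set p : Picture C := ⟨w, h, fun i j => q i j⟩ with hp
  have some_eq : ∀ i j : ℕ, i < (w : ℕ) → j < (h : ℕ) →
      p.padded (i + 1) (j + 1) = some (q i j) := fun i j hi hj => p.padded_succ hi hj
  have none_eq : ∀ i j : ℕ, i = 0 ∨ j = 0 ∨ (w : ℕ) < i ∨ (h : ℕ) < j →
      p.padded i j = none := fun i j h => p.padded_eq_none h
  refine ⟨fun i j hi hj => ?_, fun i j hi hj => ?_⟩
  · change i + 1 < (w : ℕ) + 2 at hi
    change j < (h : ℕ) + 2 at hj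
    by_cases hj' : j = 0 ∨ (h : ℕ) < j
    · rwa [none_eq _ _ (by omega), none_eq _ _ (by omega)]
    obtain ⟨j, rfl⟩ : ∃ j', j = j' + 1 := ⟨j - 1, by omega⟩
    rcases i with - | i
    · rw [none_eq _ _ (by omega), some_eq _ _ (by omega) (by omega)]
      exact hq.left j (by omega)
    rcases Nat.lt_or_ge (i + 1) w with hi' | hi'
    · rw [some_eq _ _ (by omega) (by omega), some_eq _ _ (by omega) (by omega)]
      exact hq.row i j (by omega) (by omega)
    · rw [some_eq _ _ (by omega) (by omega), none_eq _ _ (by omega)]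
      exact hq.right i j (by omega) (by omega)
  · change i < (w : ℕ) + 2 at hi
    change j + 1 < (h : ℕ) + 2 at hj
    by_cases hi' : i = 0 ∨ (w : ℕ) < i
    · rwa [none_eq _ _ (by omega), none_eq _ _ (by omega)]
    obtain ⟨i, rfl⟩ : ∃ i', i = i' + 1 := ⟨i - 1, by omega⟩
    rcases j with - | j
    · rw [none_eq _ _ (by omega), some_eq _ _ (by omega) (by omega)]
      exact hq.bottom i (by omega)
    rcases Nat.lt_or_ge (j + 1) h with hj' | hj'
    · rw [some_eq _ _ (by omega) (by omega), some_eq _ _ (by omega) (by omega)]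
      exact hq.col i j (by omega) (by omega)
    · rw [some_eq _ _ (by omega) (by omega), none_eq _ _ (by omega)]
      exact hq.top i j (by omega) (by omega)

theorem una_mem_image_iff {N : Set (ℕ+ × ℕ+)} {w h : ℕ+} :
    una w h ∈ (fun s : ℕ+ × ℕ+ => una s.1 s.2) '' N ↔ (w, h) ∈ N := by
  constructor
  · rintro ⟨⟨a, b⟩, hs, he⟩
    have h1 : a = w := congrArg Picture.width he
    have h2 : b = h := congrArg Picture.height he
    rwa [← h1, ← h2]
  · exact fun hs => ⟨(w, h), hs, rfl⟩

/-- `IsTiled` ignores the dominoes made of two frame symbols. They occur at the corners of every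
padded picture, so one picture in the language shows that they are allowed; it also supplies a
symbol of `C`. -/
theorem IsRecognizableShapeSet.exists_isTiled_iff {N : Set (ℕ+ × ℕ+)}
    (hN : IsRecognizableShapeSet N) (hne : N.Nonempty) :
    ∃ (C : Type) (_ : Finite C) (_ : Nonempty C) (H V : Set (Option C × Option C)),
      ∀ w h : ℕ+, (∃ q, IsTiled H V w h q) ↔ (w, h) ∈ N := by
  obtain ⟨C, hC, H, V, π, hL⟩ := hN
  obtain ⟨⟨a, b⟩, hab⟩ := hne
  have hmem := una_mem_image_iff.2 hab
  rw [hL] at hmem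
  obtain ⟨p, hp, -⟩ := hmem
  have hH : (none, none) ∉ H := by
    simpa [p.padded_eq_none] using hp.1 0 0 (by omega) (by omega)
  have hV : (none, none) ∉ V := by
    simpa [p.padded_eq_none] using hp.2 0 0 (by omega) (by omega)
  refine ⟨C, hC, ⟨p.cell ⟨0, p.width.pos⟩ ⟨0, p.height.pos⟩⟩, H, V, fun w h => ?_⟩
  rw [← una_mem_image_iff, hL]
  constructor
  · rintro ⟨q, hq⟩
    exact ⟨_, hq.mem_dominoLanguage hH hV, rfl⟩
  · rintro ⟨r, hr, he⟩
    have h1 : r.width = w := congrArg Picture.width he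
    have h2 : r.height = h := congrArg Picture.height he
    rw [← h1, ← h2]
    exact exists_isTiled_of_mem_dominoLanguage hr

/-! ### Shifts of finite type and gluing in terms of configurations -/

/-- Over a finite alphabet there are only finitely many patterns with support `W`; those that
violate `P` are the forbidden ones. The values of a pattern's `config` outside `W` do not matter. -/
theorem isSFT_of_local {A : Type} [Fintype A] [Inhabited A] (W : Finset (ℤ × ℤ))
    (P : (ℤ × ℤ → A) → Prop) (hP : ∀ x y, (∀ u ∈ W, x u = y u) → P x → P y) :
    IsSFT {x : ℤ × ℤ → A | ∀ v, P fun u => x (v + u)} := by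
  refine ⟨{p | p.support = W ∧ ¬ P p.config},
    (finite_setOfPred_pattern_support_eq W).subset fun p hp => hp.1, ?_⟩
  ext x
  constructor
  · rintro hx p ⟨hW, hp⟩ v hv
    exact hp (hP _ _ (fun u hu => hv u (hW ▸ hu)) (hx v))
  · intro hx v
    by_contra hv
    refine hx (Pattern.fromConfig (fun u => x (v + u)) W) ⟨rfl, fun h => hv ?_⟩ v ?_
    · exact hP _ _ (fun u hu => by simp [Pattern.fromConfig, hu]) h
    · intro u hu
      replace hu : u ∈ W := hu
      simp [Pattern.fromConfig, hu]

theorem gluesAt_iff {A : Type} [Fintype A] [Inhabited A] {X : Set (ℤ × ℤ → A)} {n : ℕ}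
    {v : ℤ × ℤ} :
    GluesAt X n v ↔ ∀ x ∈ X, ∀ y ∈ X, ∃ z ∈ X,
      ∀ u ∈ square n, z u = x u ∧ z (v + u) = y u := by
  constructor
  · intro h x hx y hy
    obtain ⟨z, hz, h1, h2⟩ := h _ ⟨x, hx, rfl⟩ _ ⟨y, hy, rfl⟩
    refine ⟨z, hz, fun u hu => ⟨?_, ?_⟩⟩
    · simpa [Pattern.fromConfig, hu] using h1 u hu
    · simpa [Pattern.fromConfig, hu] using h2 u hu
  · rintro h _ ⟨x, hx, rfl⟩ _ ⟨y, hy, rfl⟩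
    obtain ⟨z, hz, h1⟩ := h x hx y hy
    refine ⟨z, hz, fun u hu => ?_, fun u hu => ?_⟩ <;> replace hu : u ∈ square n := hu
    · simpa [Pattern.fromConfig, hu] using (h1 u hu).1
    · simpa [Pattern.fromConfig, hu] using (h1 u hu).2

theorem mem_square {n : ℕ} {i j : ℤ} :
    (i, j) ∈ square n ↔ (0 ≤ i ∧ i < n) ∧ (0 ≤ j ∧ j < n) := by
  simp [square]

/-! ### Asymptotic equivalence -/

theorem asympEq_of_eventually_eq {u v : ℕ+ → ℕ∞} {c : ℕ} (hc : c ≠ 0)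
    (hu : ∀ᶠ n in Filter.atTop, u n = c) (hv : ∀ᶠ n in Filter.atTop, v n = c) :
    AsympEq u v := by
  refine tendsto_const_nhds.congr' ?_
  filter_upwards [hu, hv] with n h1 h2
  rw [h1, h2]
  simp [ENNReal.div_self, hc]

/-- Both functions are finite and within `2 * c` of each other, while `v` tends to infinity, so `(u
- v) / v` tends to 0. -/
theorem asympEq_of_bounded_distance {u v : ℕ+ → ℕ∞} {f : ℕ+ → ℕ} (c : ℕ)
    (hf : Filter.Tendsto f Filter.atTop Filter.atTop)
    (hu : ∀ n, (f n : ℕ∞) ≤ u n + c) (hu' : ∀ n, u n ≤ f n + c)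
    (hv : ∀ n, (f n : ℕ∞) ≤ v n + c) (hv' : ∀ n, v n ≤ f n + c) : AsympEq u v := by
  have fin : ∀ {w : ℕ+ → ℕ∞}, (∀ n, w n ≤ f n + c) → ∃ a : ℕ+ → ℕ, w = fun n => (a n : ℕ∞) := by
    intro w hw
    refine ⟨fun n => (w n).toNat, funext fun n => ?_⟩
    refine (ENat.natCast_toNat (ne_top_of_le_ne_top ?_ (hw n))).symm
    exact ENat.natCast_ne_top (f n + c)
  obtain ⟨a, rfl⟩ := fin hu'
  obtain ⟨b, rfl⟩ := fin hv'
  replace hu : ∀ n, f n ≤ a n + c := fun n => by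
    have := hu n
    dsimp only at this
    exact_mod_cast this
  replace hv : ∀ n, f n ≤ b n + c := fun n => by
    have := hv n
    dsimp only at this
    exact_mod_cast this
  replace hu' : ∀ n, a n ≤ f n + c := fun n => by
    have := hu' n
    dsimp only at this
    exact_mod_cast this
  replace hv' : ∀ n, b n ≤ f n + c := fun n => by
    have := hv' n
    dsimp only at this
    exact_mod_cast this
  have hb : Filter.Tendsto (fun n => (b n : ℝ)) Filter.atTop Filter.atTop := by
    refine tendsto_natCast_atTop_atTop.comp (Filter.tendsto_atTop.2 fun m => ?_)
    filter_upwards [Filter.tendsto_atTop.1 hf (m + c)] with n hn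
    have := hv n
    omega
  have hdiff : Filter.Tendsto (fun n => ((a n : ℝ) - b n) / b n) Filter.atTop (nhds 0) := by
    refine squeeze_zero_norm (fun n => ?_)
      ((tendsto_const_nhds (x := (2 * c : ℝ))).div_atTop hb)
    rw [norm_div, Real.norm_natCast]
    gcongr
    rw [Real.norm_eq_abs, abs_le]
    have h1 : (f n : ℝ) ≤ a n + c := by exact_mod_cast hu n
    have h2 : (f n : ℝ) ≤ b n + c := by exact_mod_cast hv n
    have h3 : (a n : ℝ) ≤ f n + c := by exact_mod_cast hu' n
    have h4 : (b n : ℝ) ≤ f n + c := by exact_mod_cast hv' n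
    constructor <;> linarith
  have hlim : Filter.Tendsto (fun n => (a n : ℝ) / b n) Filter.atTop (nhds 1) := by
    have := hdiff.add_const 1
    rw [zero_add] at this
    refine this.congr' ?_
    filter_upwards [hb.eventually_gt_atTop 0] with n hn
    field_simp
    ring
  have := ENNReal.tendsto_ofReal hlim
  rw [ENNReal.ofReal_one] at this
  refine this.congr' ?_
  filter_upwards [hb.eventually_gt_atTop 0] with n hn
  rw [ENNReal.ofReal_div_of_pos hn]
  simp

/-! ### Bounded functions: the hard-core shift -/

/-- No two ones in the same row or column are at distance at most `c`. -/
def hardCore (c : ℕ) : Set (ℤ × ℤ → Bool) :=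
  {x | ∀ v, x v = true → ∀ d ∈ Finset.Icc (1 : ℤ) c,
    x (v + (d, 0)) = false ∧ x (v + (0, d)) = false}

theorem isSFT_hardCore (c : ℕ) : IsSFT (hardCore c) := by
  have key := isSFT_of_local
    (insert 0 ((Finset.Icc (1 : ℤ) c).image (fun d => (d, 0)) ∪
      (Finset.Icc (1 : ℤ) c).image (fun d => (0, d))) : Finset (ℤ × ℤ))
    (fun x : ℤ × ℤ → Bool => x 0 = true → ∀ d ∈ Finset.Icc (1 : ℤ) c,
      x (d, 0) = false ∧ x (0, d) = false) ?_
  · simpa [hardCore] using key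
  · intro x y hxy hx h0 d hd
    rw [← hxy _ (by simp)] at h0
    rw [← hxy (d, 0) (by simp_all),
      ← hxy (0, d) (by simp_all)]
    exact hx h0 d hd

theorem single_mem_hardCore (c : ℕ) (w : ℤ × ℤ) : (fun u => decide (u = w)) ∈ hardCore c := by
  intro v hv d hd
  have := (Finset.mem_Icc.1 hd).1
  obtain rfl : v = w := by simpa using hv
  constructor <;> simp [Prod.ext_iff] <;> omega

/-- Cells of the two blocks in a common row or column are more than `c` apart, so the blocks can be
placed on a background of zeros. -/
theorem gluesAt_hardCore (c n : ℕ) {v : ℤ × ℤ}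
    (hv : v = ((n : ℤ) + c, 0) ∨ v = (0, (n : ℤ) + c)) : GluesAt (hardCore c) n v := by
  rw [gluesAt_iff]
  intro x hx y hy
  have hdisj : ∀ u, u ∈ square n → u - v ∉ square n := by
    rintro ⟨i, j⟩ hu hu'
    rcases hv with rfl | rfl <;> simp only [Prod.mk_sub_mk, mem_square] at hu hu' <;> omega
  classical
  refine ⟨fun u => if u ∈ square n then x u else if u - v ∈ square n then y (u - v) else false,
    ?_, ?_⟩
  · rintro ⟨i, j⟩ hu d hd
    obtain ⟨h1, h2⟩ := Finset.mem_Icc.1 hd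
    have hxd := hx (i, j)
    have hyd := hy ((i, j) - v)
    have e1 : (i, j) + (d, 0) - v = (i, j) - v + (d, 0) := by abel
    have e2 : (i, j) + (0, d) - v = (i, j) - v + (0, d) := by abel
    simp only [e1, e2]
    by_cases h : (i, j) ∈ square n
    · simp only [h, if_true] at hu
      have := hxd hu d hd
      rcases hv with rfl | rfl <;> simp only [Prod.mk_sub_mk, Prod.mk_add_mk, mem_square] at * <;>
        constructor <;> split_ifs <;> first | exact this.1 | exact this.2 | rfl | omega
    · simp only [h, if_false] at hu
      split_ifs at hu with h'
      have := hyd hu d hd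
      rcases hv with rfl | rfl <;> simp only [Prod.mk_sub_mk, Prod.mk_add_mk, mem_square] at * <;>
        constructor <;> split_ifs <;> first | exact this.1 | exact this.2 | rfl | omega
  · intro u hu
    have h := hdisj (v + u)
    simp only [add_sub_cancel_left] at h ⊢
    have : v + u ∉ square n := fun h' => h h' hu
    simp [hu, this]

theorem le_of_gluesAt_hardCore {c n k : ℕ} (hn : 0 < n) {e : ℤ × ℤ} (he : e = (1, 0) ∨ e = (0, 1))
    (h : GluesAt (hardCore c) n (((n : ℤ) + k) • e)) : c ≤ k := by
  by_contra! hk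
  rw [gluesAt_iff] at h
  -- A one in the last column or row of the first block and one in the first of the second are at
  -- distance `k + 1`.
  obtain ⟨z, hz, hz'⟩ := h _ (single_mem_hardCore c (((n : ℤ) - 1) • e)) _
    (single_mem_hardCore c 0)
  have h1 : z (((n : ℤ) - 1) • e) = true := by
    have := (hz' (((n : ℤ) - 1) • e) (by rcases he with rfl | rfl <;> simp [mem_square] <;> omega)).1
    simpa using this
  have h2 : z (((n : ℤ) + k) • e) = true := by
    have := (hz' 0 (mem_square.2 (by omega))).2
    simpa using this
  have h3 := hz _ h1 ((k : ℤ) + 1) (by simp; omega)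
  have e1 : ((n : ℤ) + k) • e = ((n : ℤ) - 1) • e + ((k : ℤ) + 1) • e := by
    rw [← add_smul]; congr 1; ring
  rw [e1] at h2
  rcases he with rfl | rfl
  · have := h3.1
    simp_all
  · have := h3.2
    simp_all

theorem blockGluingH_hardCore (c : ℕ) {n : ℕ} (hn : 0 < n) :
    blockGluingH (hardCore c) n = c := by
  refine le_antisymm (iInf₂_le c (gluesAt_hardCore c n (Or.inl rfl))) (le_iInf₂ fun k hk => ?_)
  exact_mod_cast le_of_gluesAt_hardCore hn (Or.inl rfl) (by simpa using hk)

theorem blockGluingV_hardCore (c : ℕ) {n : ℕ} (hn : 0 < n) :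
    blockGluingV (hardCore c) n = c := by
  refine le_antisymm (iInf₂_le c (gluesAt_hardCore c n (Or.inr rfl))) (le_iInf₂ fun k hk => ?_)
  exact_mod_cast le_of_gluesAt_hardCore hn (Or.inr rfl) (by simpa using hk)

theorem exists_sft_of_eventually_const {f : ℕ+ → ℕ+} {c : ℕ+}
    (hf : ∀ᶠ n in Filter.atTop, f n = c) :
    ∃ (A : Type) (_ : Fintype A) (_ : Inhabited A) (X : Set (ℤ × ℤ → A)),
      IsSFT X ∧
      AsympEq (fun n => blockGluing X n) (fun n => blockGluingV X n) ∧
      AsympEq (fun n => blockGluingV X n) (fun n => blockGluingH X n) ∧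
      AsympEq (fun n => blockGluingH X n) (fun n => ((f n : ℕ) : ℕ∞)) := by
  have hH : ∀ n : ℕ+, blockGluingH (hardCore c) n = (c : ℕ) :=
    fun n => blockGluingH_hardCore c n.pos
  have hV : ∀ n : ℕ+, blockGluingV (hardCore c) n = (c : ℕ) :=
    fun n => blockGluingV_hardCore c n.pos
  have hB : ∀ n : ℕ+, blockGluing (hardCore c) n = (c : ℕ) :=
    fun n => by rw [blockGluing, hH, hV, max_self]
  have hc : (c : ℕ) ≠ 0 := c.ne_zero
  refine ⟨Bool, inferInstance, inferInstance, hardCore c, isSFT_hardCore c, ?_, ?_, ?_⟩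
  · exact asympEq_of_eventually_eq hc (.of_forall hB) (.of_forall hV)
  · exact asympEq_of_eventually_eq hc (.of_forall hV) (.of_forall hH)
  · exact asympEq_of_eventually_eq hc (.of_forall hH) (hf.mono fun n hn => by rw [hn])

/-! ### The shift of framed attempts -/

/-- The status of an edge of a cell: inside a rectangle, or on its boundary. -/
inductive Edge
  | inner | firm | faulty
  deriving DecidableEq

/-- The status of the upper edge of a cell; a faulty upper boundary of a rectangle has to be
justified by the left or right boundary. -/
inductive UpperEdge
  | inner | firm | faultyLeft | faultyRight
  deriving DecidableEq

instance : Finite Edge :=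
  Finite.of_surjective (fun i : Fin 3 => ![Edge.inner, .firm, .faulty] i) fun e => by
    cases e
    exacts [⟨0, rfl⟩, ⟨1, rfl⟩, ⟨2, rfl⟩]

instance : Finite UpperEdge :=
  Finite.of_surjective
    (fun i : Fin 4 => ![UpperEdge.inner, .firm, .faultyLeft, .faultyRight] i) fun e => by
    cases e
    exacts [⟨0, rfl⟩, ⟨1, rfl⟩, ⟨2, rfl⟩, ⟨3, rfl⟩]

/-- A cell of a rectangle. The flag `start` marks the rows in which a new attempt
at a picture begins. -/
@[ext]
structure Cell (C : Type) where
  left : Edge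
  right : Edge
  bottom : Edge
  top : UpperEdge
  start : Bool
  content : C

namespace Cell

variable {C : Type}

instance [Finite C] : Finite (Cell C) :=
  Finite.of_injective
    (fun c : Cell C => (c.left, c.right, c.bottom, c.top, c.start, c.content))
    fun c d h => by
      simp only [Prod.mk.injEq] at h
      exact Cell.ext h.1 h.2.1 h.2.2.1 h.2.2.2.1 h.2.2.2.2.1 h.2.2.2.2.2

/-- Faulty cells are exempt from the domino constraints. -/
def Faulty (c : Cell C) : Prop :=
  c.left = .faulty ∨ c.right = .faulty ∨ c.bottom = .faulty ∨
    c.top = .faultyLeft ∨ c.top = .faultyRight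

/-- The rectangle consisting of a single faulty cell. -/
def filler (s : C) : Cell C := ⟨.faulty, .faulty, .faulty, .firm, false, s⟩

/-- The constraints on a single cell. -/
structure Valid (H V : Set (Option C × Option C)) (c : Cell C) : Prop where
  faultyLeft : c.top = .faultyLeft → c.left ≠ .firm
  faultyRight : c.top = .faultyRight → c.right ≠ .firm
  firm_start : c.bottom = .firm → c.start = true
  left_content : ¬ c.Faulty → c.left = .firm → (none, some c.content) ∉ H
  right_content : ¬ c.Faulty → c.right = .firm → (some c.content, none) ∉ H
  start_content : ¬ c.Faulty → c.start = true → (none, some c.content) ∉ V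
  top_content : ¬ c.Faulty → c.top = .firm → (some c.content, none) ∉ V

/-- The constraints on a cell `c` and its right neighbour `d`. -/
structure FitsH (H : Set (Option C × Option C)) (c d : Cell C) : Prop where
  inner_iff : c.right = .inner ↔ d.left = .inner
  bottom : c.right = .inner → c.bottom = d.bottom
  top : c.right = .inner → c.top = d.top
  start : c.right = .inner → c.start = d.start
  content : ¬ c.Faulty → ¬ d.Faulty → c.right = .inner →
    (some c.content, some d.content) ∉ H

/-- The constraints on a cell `c` and its upper neighbour `d`. -/
structure FitsV (V : Set (Option C × Option C)) (c d : Cell C) : Prop where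
  inner_iff : c.top = .inner ↔ d.bottom = .inner
  left : c.top = .inner → c.left = d.left
  right : c.top = .inner → c.right = d.right
  -- A row with `start` set is detached from the row below, so the picture below may be left
  -- unfinished.
  content : ¬ c.Faulty → ¬ d.Faulty → c.top = .inner → d.start = false →
    (some c.content, some d.content) ∉ V

end Cell

/-- The plane is tiled by rectangles; each fault-free rectangle carries a stack of attempts
at pictures of the domino language, the last of which is completed at its top. -/
structure IsFraming {C : Type} (H V : Set (Option C × Option C)) (x : ℤ → ℤ → Cell C) :
    Prop where
  valid : ∀ i j, (x i j).Valid H V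
  fitsH : ∀ i j, (x i j).FitsH H (x (i + 1) j)
  fitsV : ∀ i j, (x i j).FitsV V (x i (j + 1))

/-! ### Cells that close a cut rectangle with a fault -/

namespace Cell

variable {C : Type} {H V : Set (Option C × Option C)}

theorem valid_filler (s : C) : (filler s).Valid H V := by
  constructor <;> simp [filler, Faulty]

theorem fitsH_of_ne {c d : Cell C} (hc : c.right ≠ .inner) (hd : d.left ≠ .inner) :
    c.FitsH H d := by
  constructor <;> simp_all

theorem fitsV_of_ne {c d : Cell C} (hc : c.top ≠ .inner) (hd : d.bottom ≠ .inner) :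
    c.FitsV V d := by
  constructor <;> simp_all

/-- The cell to the right of `c` that closes the rectangle of `c`. -/
def closeRight (c : Cell C) : Cell C :=
  if c.right = .inner then ⟨.inner, .faulty, c.bottom, c.top, c.start, c.content⟩
  else filler c.content

/-- The cell to the left of `c` that closes the rectangle of `c`. -/
def closeLeft (c : Cell C) : Cell C :=
  if c.left = .inner then ⟨.faulty, .inner, c.bottom, c.top, c.start, c.content⟩
  else filler c.content

/-- The cell below `c` that closes the rectangle of `c`. -/
def closeBottom (c : Cell C) : Cell C :=
  if c.bottom = .inner then ⟨c.left, c.right, .faulty, .inner, c.start, c.content⟩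
  else filler c.content

theorem faulty_closeRight (c : Cell C) : c.closeRight.Faulty := by
  unfold closeRight; split_ifs <;> simp [Faulty, filler]

theorem faulty_closeLeft (c : Cell C) : c.closeLeft.Faulty := by
  unfold closeLeft; split_ifs <;> simp [Faulty, filler]

theorem faulty_closeBottom (c : Cell C) : c.closeBottom.Faulty := by
  unfold closeBottom; split_ifs <;> simp [Faulty, filler]

theorem right_closeRight (c : Cell C) : c.closeRight.right = .faulty := by
  unfold closeRight; split_ifs <;> rfl

theorem left_closeLeft (c : Cell C) : c.closeLeft.left = .faulty := by
  unfold closeLeft; split_ifs <;> rfl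

theorem bottom_closeBottom (c : Cell C) : c.closeBottom.bottom = .faulty := by
  unfold closeBottom; split_ifs <;> rfl

end Cell

namespace Cell

variable {C : Type} {H V : Set (Option C × Option C)} {c d : Cell C}

/-- The added cell is faulty, which voids the content rules. A top labelled `faultyRight` is
justified by the new faulty edge, one labelled `faultyLeft` by the inner left edge. -/
theorem Valid.closeRight (hc : c.Valid H V) : c.closeRight.Valid H V := by
  obtain ⟨h1, h2, h3, -⟩ := hc
  unfold Cell.closeRight
  split_ifs with h
  · constructor <;> simp_all [Faulty]
  · exact valid_filler _

theorem Valid.closeLeft (hc : c.Valid H V) : c.closeLeft.Valid H V := by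
  obtain ⟨h1, h2, h3, -⟩ := hc
  unfold Cell.closeLeft
  split_ifs with h
  · constructor <;> simp_all [Faulty]
  · exact valid_filler _

theorem Valid.closeBottom (hc : c.Valid H V) : c.closeBottom.Valid H V := by
  obtain ⟨h1, h2, h3, -⟩ := hc
  unfold Cell.closeBottom
  split_ifs with h
  · constructor <;> simp_all [Faulty]
  · exact valid_filler _

theorem fitsH_closeRight (c : Cell C) : c.FitsH H c.closeRight := by
  unfold Cell.closeRight
  split_ifs with h
  · constructor <;> simp_all [Faulty]
  · exact fitsH_of_ne h (by simp [filler])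

theorem closeLeft_fitsH (c : Cell C) : c.closeLeft.FitsH H c := by
  unfold Cell.closeLeft
  split_ifs with h
  · constructor <;> simp_all [Faulty]
  · exact fitsH_of_ne (by simp [filler]) h

theorem closeBottom_fitsV (c : Cell C) : c.closeBottom.FitsV V c := by
  unfold Cell.closeBottom
  split_ifs with h
  · constructor <;> simp_all [Faulty]
  · exact fitsV_of_ne (by simp [filler]) h

/-- The closing cell is computed from its neighbour alone, and vertically joined cells agree on
their sides, so the closing cells of a column fit on top of each other. -/
theorem FitsV.closeRight (h : c.FitsV V d) : c.closeRight.FitsV V d.closeRight := by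
  have hf := c.faulty_closeRight
  obtain ⟨h1, h2, h3, -⟩ := h
  refine ⟨?_, ?_, ?_, fun h => absurd hf h⟩ <;> unfold Cell.closeRight <;> split_ifs <;>
    grind [filler]

theorem FitsV.closeLeft (h : c.FitsV V d) : c.closeLeft.FitsV V d.closeLeft := by
  have hf := c.faulty_closeLeft
  obtain ⟨h1, h2, h3, -⟩ := h
  refine ⟨?_, ?_, ?_, fun h => absurd hf h⟩ <;> unfold Cell.closeLeft <;> split_ifs <;>
    grind [filler]

theorem FitsH.closeBottom (h : c.FitsH H d) : c.closeBottom.FitsH H d.closeBottom := by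
  have hf := c.faulty_closeBottom
  obtain ⟨h1, h2, h3, h4, -⟩ := h
  refine ⟨?_, ?_, ?_, ?_, fun h => absurd hf h⟩ <;> unfold Cell.closeBottom <;> split_ifs <;>
    grind [filler]

end Cell

/-! ### Closing framings on the left, right and bottom -/

namespace IsFraming

open Cell

variable {C : Type} {H V : Set (Option C × Option C)} {x y : ℤ → ℤ → Cell C}

theorem shift (hx : IsFraming H V x) (a b : ℤ) : IsFraming H V fun i j => x (i + a) (j + b) where
  valid _ _ := hx.valid _ _
  fitsH i j := by rw [add_right_comm]; exact hx.fitsH _ _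
  fitsV i j := by rw [add_right_comm]; exact hx.fitsV _ _

theorem const_filler (s : C) : IsFraming H V fun _ _ => filler s where
  valid _ _ := valid_filler s
  fitsH _ _ := fitsH_of_ne (by simp [filler]) (by simp [filler])
  fitsV _ _ := fitsV_of_ne (by simp [filler]) (by simp [filler])

theorem concatH (hx : IsFraming H V x) (hy : IsFraming H V y) {M : ℤ}
    (h : ∀ j, (x (M - 1) j).FitsH H (y M j)) :
    IsFraming H V fun i j => if i < M then x i j else y i j where
  valid i j := by
    split_ifs
    exacts [hx.valid _ _, hy.valid _ _]
  fitsH i j := by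
    split_ifs with h1 h2 h3
    · exact hx.fitsH _ _
    · obtain rfl : M = i + 1 := by omega
      simpa using h j
    · omega
    · exact hy.fitsH _ _
  fitsV i j := by
    split_ifs
    exacts [hx.fitsV _ _, hy.fitsV _ _]

theorem concatV (hx : IsFraming H V x) (hy : IsFraming H V y) {M : ℤ}
    (h : ∀ i, (x i (M - 1)).FitsV V (y i M)) :
    IsFraming H V fun i j => if j < M then x i j else y i j where
  valid i j := by
    split_ifs
    exacts [hx.valid _ _, hy.valid _ _]
  fitsH i j := by
    split_ifs
    exacts [hx.fitsH _ _, hy.fitsH _ _]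
  fitsV i j := by
    split_ifs with h1 h2 h3
    · exact hx.fitsV _ _
    · obtain rfl : M = j + 1 := by omega
      simpa using h i
    · omega
    · exact hy.fitsV _ _

theorem exists_closed_right (hx : IsFraming H V x) (M : ℤ) :
    ∃ z, IsFraming H V z ∧ (∀ i j, i < M → z i j = x i j) ∧
      ∀ i j, M ≤ i → (z i j).right = .faulty := by
  refine ⟨fun i j => if i < M then x i j else if i = M then (x (M - 1) j).closeRight
      else filler (x i j).content, ⟨fun i j => ?_, fun i j => ?_, fun i j => ?_⟩,
    fun i j hi => by simp [hi], fun i j hi => ?_⟩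
  · split_ifs
    exacts [hx.valid _ _, (hx.valid _ _).closeRight, valid_filler _]
  · split_ifs with h1 h2 h3 <;> try omega
    · exact hx.fitsH _ _
    · obtain rfl : M = i + 1 := h3.symm
      simpa using fitsH_closeRight (x i j)
    all_goals exact fitsH_of_ne (by simp [filler, right_closeRight]) (by simp [filler])
  · split_ifs
    exacts [hx.fitsV _ _, (hx.fitsV _ _).closeRight, fitsV_of_ne (by simp [filler]) (by simp [filler])]
  · simp only [not_lt.2 hi, if_false]
    split_ifs
    exacts [right_closeRight _, rfl]

theorem exists_closed_left (hx : IsFraming H V x) (M : ℤ) :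
    ∃ z, IsFraming H V z ∧ (∀ i j, M ≤ i → z i j = x i j) ∧
      ∀ i j, i < M → (z i j).left = .faulty := by
  refine ⟨fun i j => if M ≤ i then x i j else if i = M - 1 then (x M j).closeLeft
      else filler (x i j).content, ⟨fun i j => ?_, fun i j => ?_, fun i j => ?_⟩,
    fun i j hi => by simp [hi], fun i j hi => ?_⟩
  · split_ifs
    exacts [hx.valid _ _, (hx.valid _ _).closeLeft, valid_filler _]
  · split_ifs with h1 h2 h3 <;> try omega
    · exact hx.fitsH _ _
    · obtain rfl : M = i + 1 := by omega
      exact closeLeft_fitsH _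
    all_goals exact fitsH_of_ne (by simp [filler]) (by simp [filler, left_closeLeft])
  · split_ifs
    exacts [hx.fitsV _ _, (hx.fitsV _ _).closeLeft, fitsV_of_ne (by simp [filler]) (by simp [filler])]
  · simp only [not_le.2 hi, if_false]
    split_ifs
    exacts [left_closeLeft _, rfl]

theorem exists_closed_bottom (hx : IsFraming H V x) (M : ℤ) :
    ∃ z, IsFraming H V z ∧ (∀ i j, M ≤ j → z i j = x i j) ∧
      (∀ i j, j < M → (z i j).bottom = .faulty) ∧
      (∀ i, (∀ j, (x i j).left = .faulty) → ∀ j, (z i j).left = .faulty) ∧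
      ∀ i, (∀ j, (x i j).right = .faulty) → ∀ j, (z i j).right = .faulty := by
  refine ⟨fun i j => if M ≤ j then x i j else if j = M - 1 then (x i M).closeBottom
      else filler (x i j).content, ⟨fun i j => ?_, fun i j => ?_, fun i j => ?_⟩,
    fun i j hi => by simp [hi], fun i j hi => ?_, fun i hi j => ?_, fun i hi j => ?_⟩
  · split_ifs
    exacts [hx.valid _ _, (hx.valid _ _).closeBottom, valid_filler _]
  · split_ifs
    exacts [hx.fitsH _ _, (hx.fitsH _ _).closeBottom, fitsH_of_ne (by simp [filler]) (by simp [filler])]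
  · split_ifs with h1 h2 h3 <;> try omega
    · exact hx.fitsV _ _
    · obtain rfl : M = j + 1 := by omega
      exact closeBottom_fitsV _
    all_goals exact fitsV_of_ne (by simp [filler]) (by simp [filler, bottom_closeBottom])
  · simp only [not_le.2 hi, if_false]
    split_ifs
    exacts [bottom_closeBottom _, rfl]
  all_goals
    dsimp only
    split_ifs
    · exact hi j
    · unfold closeBottom
      split_ifs
      exacts [hi M, rfl]
    · rfl

end IsFraming

/-! ### Runs: the rows of rectangles of finite width -/

/-- The cells `c a, …, c b` form a full row of a rectangle. -/
structure IsRun {C : Type} (c : ℤ → Cell C) (a b : ℤ) : Prop where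
  le : a ≤ b
  left : (c a).left ≠ .inner
  right : (c b).right ≠ .inner
  right_inner : ∀ k, a ≤ k → k < b → (c k).right = .inner
  left_inner : ∀ k, a < k → k ≤ b → (c k).left = .inner

namespace IsRun

variable {C : Type} {H V : Set (Option C × Option C)} {c : ℤ → Cell C} {a b a' b' i : ℤ}

theorem unique (h : IsRun c a b) (h' : IsRun c a' b') (ha : a ≤ i) (hb : i ≤ b) (ha' : a' ≤ i)
    (hb' : i ≤ b') : a = a' ∧ b = b' := by
  have e1 : ¬ a < a' := fun hlt => h'.left (h.left_inner _ hlt (by omega))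
  have e2 : ¬ a' < a := fun hlt => h.left (h'.left_inner _ hlt (by omega))
  have e3 : ¬ b < b' := fun hlt => h.right (h'.right_inner _ (by omega) hlt)
  have e4 : ¬ b' < b := fun hlt => h'.right (h.right_inner _ (by omega) hlt)
  omega

/-- The nearest non-inner left edge at or before `i` and right edge at or after `i` delimit the run;
the bounds `l` and `r` guarantee that both exist. -/
theorem exists_of_bounded (hc : ∀ i, (c i).FitsH H (c (i + 1))) {l r : ℤ}
    (hl : ∀ i < l, (c i).left ≠ .inner) (hr : ∀ i, r ≤ i → (c i).right ≠ .inner) (i : ℤ) :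
    ∃ a b, IsRun c a b ∧ a ≤ i ∧ i ≤ b := by
  obtain ⟨a, ⟨ha, hai⟩, ha'⟩ := Int.exists_greatest_of_bdd
    (P := fun a => (c a).left ≠ .inner ∧ a ≤ i) ⟨i, fun z hz => hz.2⟩
    ⟨min i (l - 1), hl _ (by omega), by omega⟩
  obtain ⟨b, ⟨hb, hib⟩, hb'⟩ := Int.exists_least_of_bdd
    (P := fun b => (c b).right ≠ .inner ∧ i ≤ b) ⟨i, fun z hz => hz.2⟩
    ⟨max i r, hr _ (by omega), by omega⟩
  have key : ∀ k, a ≤ k → k < b → (c k).right = .inner := by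
    intro k h1 h2
    by_contra h
    by_cases hk : i ≤ k
    · have := hb' k ⟨h, hk⟩
      omega
    · have h3 := ha' (k + 1) ⟨fun h4 => h ((hc k).inner_iff.2 h4), by omega⟩
      omega
  refine ⟨a, b, ⟨by omega, ha, hb, key, fun k h1 h2 => ?_⟩, hai, hib⟩
  have := (hc (k - 1)).inner_iff.1 (key _ (by omega) (by omega))
  simpa using this

theorem top_eq (h : IsRun c a b) (hc : ∀ i, (c i).FitsH H (c (i + 1))) (ha : a ≤ i)
    (hb : i ≤ b) : (c i).top = (c a).top := by
  induction i, ha using Int.leInduction with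
  | base => rfl
  | succ k hk ih =>
    rw [← ih (by omega)]
    exact ((hc k).top (h.right_inner k hk (by omega))).symm

end IsRun

/-- The cell at height `j` of a block of `g` rows put on top of a rectangle, above the cell `c`. -/
def Cell.stacked {C : Type} (c : Cell C) (τ : UpperEdge) (g j : ℕ) (s : C) : Cell C :=
  ⟨c.left, c.right, .inner, if j + 1 = g then τ else .inner, decide (j = 0), s⟩

/-- The columns `B a, …, B b` can be put on top of the run `c a, …, c b`; from row `F` on they
contain no unfinished rectangle. -/
structure IsRoof {C : Type} (H V : Set (Option C × Option C)) (c : ℤ → Cell C) (a b : ℤ) (F : ℕ)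
    (B : ℤ → ℕ → Cell C) : Prop where
  valid : ∀ i j, a ≤ i → i ≤ b → (B i j).Valid H V
  fitsH : ∀ i j, a ≤ i → i < b → (B i j).FitsH H (B (i + 1) j)
  fitsV : ∀ i j, a ≤ i → i ≤ b → (B i j).FitsV V (B i (j + 1))
  base : ∀ i, a ≤ i → i ≤ b → (c i).FitsV V (B i 0)
  top : ∀ i j, F ≤ j → (B i j).top ≠ .inner
  left : ∀ j, (B a j).left ≠ .inner
  right : ∀ j, (B b j).right ≠ .inner
  left_faulty : ∀ i j, (c i).left = .faulty → (B i j).left = .faulty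
  right_faulty : ∀ i j, (c i).right = .faulty → (B i j).right = .faulty

namespace IsRun

open Cell

variable {C : Type} {H V : Set (Option C × Option C)} {c : ℤ → Cell C} {a b : ℤ} {F : ℕ}

theorem isRoof_filler (htop : ∀ i, a ≤ i → i ≤ b → (c i).top ≠ .inner) :
    IsRoof H V c a b F fun i _ => filler (c i).content where
  valid _ _ _ _ := valid_filler _
  fitsH _ _ _ _ := fitsH_of_ne (by simp [filler]) (by simp [filler])
  fitsV _ _ _ _ := fitsV_of_ne (by simp [filler]) (by simp [filler])
  base i h1 h2 := fitsV_of_ne (htop i h1 h2) (by simp [filler])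
  top _ _ _ := by simp [filler]
  left _ := by simp [filler]
  right _ := by simp [filler]
  left_faulty _ _ _ := rfl
  right_faulty _ _ _ := rfl

theorem isRoof_stacked (h : IsRun c a b) (hc : ∀ i, (c i).FitsH H (c (i + 1)))
    (htop : ∀ i, a ≤ i → i ≤ b → (c i).top = .inner) {g : ℕ} (hg : 0 < g) (hgF : g ≤ F)
    {τ : UpperEdge} (hτ : τ ≠ .inner) (κ : ℤ → ℕ → C)
    (hvalid : ∀ i j, a ≤ i → i ≤ b → j < g → ((c i).stacked τ g j (κ i j)).Valid H V)
    (hH : ∀ i j, a ≤ i → i < b → j < g → ¬ ((c i).stacked τ g j (κ i j)).Faulty →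
      (some (κ i j), some (κ (i + 1) j)) ∉ H)
    (hV : ∀ i j, a ≤ i → i ≤ b → j + 1 < g → (some (κ i j), some (κ i (j + 1))) ∉ V) :
    IsRoof H V c a b F
      fun i j => if j < g then (c i).stacked τ g j (κ i j) else filler (c i).content where
  valid i j h1 h2 := by
    split_ifs with h3
    exacts [hvalid i j h1 h2 h3, valid_filler _]
  fitsH i j h1 h2 := by
    split_ifs with h3
    · exact ⟨(hc i).inner_iff, fun _ => rfl, fun _ => rfl, fun _ => rfl,
        fun h4 _ _ => hH i j h1 h2 h3 h4⟩
    · exact fitsH_of_ne (by simp [filler]) (by simp [filler])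
  fitsV i j h1 h2 := by
    split_ifs with h3 h4 h4
    · have e : j + 1 ≠ g := by omega
      refine ⟨by simp [stacked, e], fun _ => rfl, fun _ => rfl, fun _ _ _ _ => hV i j h1 h2 h4⟩
    · have e : j + 1 = g := by omega
      exact fitsV_of_ne (by simp [stacked, e, hτ]) (by simp [filler])
    · omega
    · exact fitsV_of_ne (by simp [filler]) (by simp [filler])
  base i h1 h2 := by
    rw [if_pos hg]
    -- Row 0 of the block has `start` set, so the old content below imposes no domino constraint.
    constructor <;> simp [htop i h1 h2, stacked]
  top i j hj := by
    rw [if_neg (by omega)]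
    simp [filler]
  left j := by
    split_ifs
    exacts [h.left, by simp [filler]]
  right j := by
    split_ifs
    exacts [h.right, by simp [filler]]
  left_faulty i j hi := by
    split_ifs
    exacts [hi, rfl]
  right_faulty i j hi := by
    split_ifs
    exacts [hi, rfl]

/-- A finished rectangle gets fillers. An unfinished one with a faulty side gets a single row with a
faulty top justified by that side. Only two firm sides force a whole picture to be stacked, which is
what `hF` provides. -/
theorem exists_isRoof (h : IsRun c a b) (hc : ∀ i, (c i).FitsH H (c (i + 1))) (hF0 : 1 ≤ F)
    (hF : (c a).left = .firm → (c b).right = .firm →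
      ∃ g, 0 < g ∧ g ≤ F ∧ ∃ q, IsTiled H V (b - a + 1).toNat g q) :
    ∃ B, IsRoof H V c a b F B := by
  have hab := h.le
  by_cases htop : (c a).top = .inner
  swap
  · exact ⟨_, isRoof_filler fun i h1 h2 => by rwa [h.top_eq hc h1 h2]⟩
  replace htop : ∀ i, a ≤ i → i ≤ b → (c i).top = .inner := fun i h1 h2 => by
    rwa [h.top_eq hc h1 h2]
  have hleft : ∀ i, a ≤ i → i ≤ b → (c i).left ≠ .inner → i = a := fun i h1 h2 h3 => by
    by_contra h4
    exact h3 (h.left_inner i (by omega) h2)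
  have hright : ∀ i, a ≤ i → i ≤ b → (c i).right ≠ .inner → i = b := fun i h1 h2 h3 => by
    by_contra h4
    exact h3 (h.right_inner i h1 (by omega))
  by_cases hl : (c a).left = .faulty
  · refine ⟨_, h.isRoof_stacked hc htop one_pos hF0 (τ := .faultyLeft) (by simp)
      (fun i _ => (c i).content) ?_ ?_ (by omega)⟩
    · intro i j h1 h2 h3
      obtain rfl : j = 0 := by omega
      have : (c i).left ≠ .firm := fun h4 => by
        obtain rfl := hleft i h1 h2 (by simp [h4])
        simp [hl] at h4
      constructor <;> simp [stacked, Faulty, this]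
    · intro i j h1 h2 h3 h4
      obtain rfl : j = 0 := by omega
      simp [stacked, Faulty] at h4
  by_cases hr : (c b).right = .faulty
  · refine ⟨_, h.isRoof_stacked hc htop one_pos hF0 (τ := .faultyRight) (by simp)
      (fun i _ => (c i).content) ?_ ?_ (by omega)⟩
    · intro i j h1 h2 h3
      obtain rfl : j = 0 := by omega
      have : (c i).right ≠ .firm := fun h4 => by
        obtain rfl := hright i h1 h2 (by simp [h4])
        simp [hr] at h4
      constructor <;> simp [stacked, Faulty, this]
    · intro i j h1 h2 h3 h4
      obtain rfl : j = 0 := by omega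
      simp [stacked, Faulty] at h4
  have hl' : (c a).left = .firm := by
    cases e : (c a).left
    exacts [absurd e h.left, rfl, absurd e hl]
  have hr' : (c b).right = .firm := by
    cases e : (c b).right
    exacts [absurd e h.right, rfl, absurd e hr]
  obtain ⟨g, hg, hgF, q, hq⟩ := hF hl' hr'
  refine ⟨_, h.isRoof_stacked hc htop hg hgF (τ := .firm) (by simp)
    (fun i j => q (i - a).toNat j) ?_ ?_ ?_⟩
  · intro i j h1 h2 h3
    refine ⟨?_, ?_, by simp [stacked], fun _ h4 => ?_, fun _ h4 => ?_, fun _ h4 => ?_,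
      fun _ h4 => ?_⟩
    · simp only [stacked]
      split_ifs <;> simp
    · simp only [stacked]
      split_ifs <;> simp
    · obtain rfl := hleft i h1 h2 (fun h5 => by simp [stacked, h5] at h4)
      simpa [stacked] using hq.left j h3
    · obtain rfl := hright i h1 h2 (fun h5 => by simp [stacked, h5] at h4)
      exact hq.right _ j (by omega) h3
    · obtain rfl : j = 0 := by simpa [stacked] using h4
      exact hq.bottom _ (by omega)
    · refine hq.top _ j (by omega) ?_
      simpa [stacked] using h4
  · intro i j h1 h2 h3 _
    have := hq.row (i - a).toNat j (by omega) h3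
    rwa [show (i - a).toNat + 1 = (i + 1 - a).toNat by omega] at this
  · intro i j h1 h2 h3
    exact hq.col _ j (by omega) h3

end IsRun

/-! ### Closing at the top, and the upper bound for gluing -/

namespace IsFraming

open Cell

variable {C : Type} {H V : Set (Option C × Option C)} {x : ℤ → ℤ → Cell C}

theorem exists_closed_top (hx : IsFraming H V x) {n F : ℕ} (M : ℤ) (hF0 : 1 ≤ F)
    (hF : ∀ w : ℕ, 0 < w → w ≤ n → ∃ g, 0 < g ∧ g ≤ F ∧ ∃ q, IsTiled H V w g q)
    (hl : ∀ i j, i < 0 → (x i j).left = .faulty)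
    (hr : ∀ i j, (n : ℤ) ≤ i → (x i j).right = .faulty) :
    ∃ z, IsFraming H V z ∧ (∀ i j, j < M → z i j = x i j) ∧
      (∀ i j, M + F ≤ j → (z i j).top ≠ .inner) ∧
      (∀ i j, i < 0 → (z i j).left = .faulty) ∧
      ∀ i j, (n : ℤ) ≤ i → (z i j).right = .faulty := by
  have hc : ∀ i, (x i (M - 1)).FitsH H (x (i + 1) (M - 1)) := fun i => hx.fitsH i (M - 1)
  choose a b hrun ha hb using IsRun.exists_of_bounded hc (l := 0) (r := n)
    (fun i hi => by simp [hl i _ hi]) (fun i hi => by simp [hr i _ hi])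
  have hroof : ∀ a b, IsRun (fun i => x i (M - 1)) a b →
      ∃ B, IsRoof H V (fun i => x i (M - 1)) a b F B := by
    intro a b hab
    refine hab.exists_isRoof hc hF0 fun h1 h2 => hF _ ?_ ?_
    · have := hab.le
      omega
    -- Outside the columns of the window the relevant edges are faulty, so a run with two firm ends
    -- lies inside and has width at most `n`.
    · have h3 : 0 ≤ a := by
        by_contra! h
        simp [hl a _ h] at h1
      have h4 : b < n := by
        by_contra! h
        simp [hr b _ h] at h2
      omega
  have : Nonempty (ℤ → ℕ → Cell C) := ⟨fun i _ => x i 0⟩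
  -- The roof depends on the run only, not on the column `i`, so columns of the same run receive
  -- parts of the same roof.
  choose! B hB using hroof
  set T : ℤ → ℕ → Cell C := fun i j => B (a i) (b i) i j with hT
  have hBi : ∀ i, IsRoof H V (fun i => x i (M - 1)) (a i) (b i) F (B (a i) (b i)) :=
    fun i => hB _ _ (hrun i)
  have hTH : ∀ i j, (T i j).FitsH H (T (i + 1) j) := by
    intro i j
    have h1 := hb i
    have h2 := ha (i + 1)
    by_cases h : i + 1 ≤ b i
    · obtain ⟨e1, e2⟩ := (hrun i).unique (hrun (i + 1)) (by have := ha i; omega) h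
        (ha (i + 1)) (hb (i + 1))
      simp only [hT, ← e1, ← e2]
      exact (hBi i).fitsH i j (ha i) (by omega)
    · have e1 : b i = i := by omega
      have e2 : a (i + 1) = i + 1 := by
        by_contra h3
        have e3 := ((hrun i).unique (hrun (i + 1)) (ha i) h1 (by omega)
          (by have := hb (i + 1); omega)).2
        have := hb (i + 1)
        omega
      refine fitsH_of_ne ?_ ?_
      · have := (hBi i).right j
        simpa only [hT, e1] using this
      · have := (hBi (i + 1)).left j
        simpa only [hT, e2] using this
  refine ⟨fun i j => if j < M then x i j else T i (j - M).toNat,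
    ⟨fun i j => ?_, fun i j => ?_, fun i j => ?_⟩, fun i j hj => by simp [hj],
    fun i j hj => ?_, fun i j hi => ?_, fun i j hi => ?_⟩
  · split_ifs
    exacts [hx.valid _ _, (hBi i).valid _ _ (ha i) (hb i)]
  · split_ifs
    exacts [hx.fitsH _ _, hTH _ _]
  · split_ifs with h1 h2 h3
    · exact hx.fitsV _ _
    · obtain rfl : M = j + 1 := by omega
      have := (hBi i).base i (ha i) (hb i)
      simpa using this
    · omega
    · have := (hBi i).fitsV i (j - M).toNat (ha i) (hb i)
      rwa [show (j - M).toNat + 1 = (j + 1 - M).toNat by omega] at this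
  · simp only [show ¬ j < M by omega, if_false]
    exact (hBi i).top _ _ (by omega)
  · dsimp only
    split_ifs
    exacts [hl i j hi, (hBi i).left_faulty _ _ (hl i _ hi)]
  · dsimp only
    split_ifs
    exacts [hr i j hi, (hBi i).right_faulty _ _ (hr i _ hi)]

/-- Every square of a framing can be closed up with a margin of width `1` on the left, on the
right and below, and of width `F` above. -/
theorem exists_closed (hx : IsFraming H V x) {n F : ℕ} (hF0 : 1 ≤ F)
    (hF : ∀ w : ℕ, 0 < w → w ≤ n → ∃ g, 0 < g ∧ g ≤ F ∧ ∃ q, IsTiled H V w g q) :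
    ∃ z, IsFraming H V z ∧
      (∀ i j : ℤ, 0 ≤ i → i < n → 0 ≤ j → j < n → z i j = x i j) ∧
      (∀ i j, i < 0 → (z i j).left ≠ .inner) ∧
      (∀ i j, (n : ℤ) ≤ i → (z i j).right ≠ .inner) ∧
      (∀ i j, j < 0 → (z i j).bottom ≠ .inner) ∧
      ∀ i j, (n : ℤ) + F ≤ j → (z i j).top ≠ .inner := by
  -- The top is closed last: its roofs need runs bounded by the faults on the left and right.
  obtain ⟨x₁, h₁, e₁, r₁⟩ := hx.exists_closed_right n
  obtain ⟨x₂, h₂, e₂, l₂⟩ := h₁.exists_closed_left 0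
  have r₂ : ∀ i j, (n : ℤ) ≤ i → (x₂ i j).right = .faulty := fun i j hi => by
    rw [e₂ i j (by omega), r₁ i j hi]
  obtain ⟨x₃, h₃, e₃, b₃, l₃, r₃⟩ := h₂.exists_closed_bottom 0
  obtain ⟨z, hz, e, t, l, r⟩ := h₃.exists_closed_top (n := n) (n : ℤ) hF0 hF
    (fun i j hi => l₃ i (fun j => l₂ i j hi) j) (fun i j hi => r₃ i (fun j => r₂ i j hi) j)
  refine ⟨z, hz, fun i j h1 h2 h3 h4 => ?_, fun i j hi => by simp [l i j hi],
    fun i j hi => by simp [r i j hi], fun i j hj => ?_, t⟩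
  · rw [e i j h4, e₃ i j h3, e₂ i j h1, e₁ i j h2]
  · rw [e i j (by omega), b₃ i j hj]
    simp

/-- Squares of framings can be glued at every large distance. -/
theorem exists_glued {y : ℤ → ℤ → Cell C} (hx : IsFraming H V x) (hy : IsFraming H V y) {n F k : ℕ}
    (hF0 : 1 ≤ F) (hF : ∀ w : ℕ, 0 < w → w ≤ n → ∃ g, 0 < g ∧ g ≤ F ∧ ∃ q, IsTiled H V w g q)
    (hk : F + 2 ≤ k) {v : ℤ × ℤ} (hv : v = ((n : ℤ) + k, 0) ∨ v = (0, (n : ℤ) + k)) :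
    ∃ z, IsFraming H V z ∧ ∀ i j : ℤ, 0 ≤ i → i < n → 0 ≤ j → j < n →
      z i j = x i j ∧ z (v.1 + i) (v.2 + j) = y i j := by
  obtain ⟨x', hx', ex, -, rx, -, tx⟩ := hx.exists_closed hF0 hF
  obtain ⟨y', hy', ey, ly, -, by', -⟩ := hy.exists_closed hF0 hF
  have hy'' := hy'.shift (-v.1) (-v.2)
  rcases hv with rfl | rfl
  · refine ⟨_, hx'.concatH hy'' (M := n + k - 1)
      fun j => fitsH_of_ne (rx _ _ (by omega)) (ly _ _ (by dsimp only; omega)), ?_⟩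
    intro i j h1 h2 h3 h4
    rw [if_pos (by omega), if_neg (by dsimp only; omega), ex i j h1 h2 h3 h4, ← ey i j h1 h2 h3 h4]
    exact ⟨rfl, by congr 1 <;> ring⟩
  -- Besides the `F` roof rows, the gap needs row `n + F`, where no top is inner, and the row
  -- closing `y` from below: hence `F + 2 ≤ k`.
  · refine ⟨_, hx'.concatV hy'' (M := n + k - 1)
      fun i => fitsV_of_ne (tx _ _ (by omega)) (by' _ _ (by dsimp only; omega)), ?_⟩
    intro i j h1 h2 h3 h4
    rw [if_pos (by omega), if_neg (by dsimp only; omega), ex i j h1 h2 h3 h4, ← ey i j h1 h2 h3 h4]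
    exact ⟨rfl, by congr 1 <;> ring⟩

end IsFraming

/-! ### Firm rectangles and the obstruction to gluing -/

/-- The cell at position `(i, j)` of a `w × h` rectangle with firm edges. -/
def framedCell {C : Type} (w h : ℕ) (i j : ℤ) (s : C) : Cell C :=
  ⟨if i = 0 then .firm else .inner, if i + 1 = w then .firm else .inner,
    if j = 0 then .firm else .inner, if j + 1 = h then .firm else .inner, decide (j = 0), s⟩

/-- A tiled rectangle with firm edges on a background of fillers. -/
def framedRectangle {C : Type} (w h : ℕ) (q : ℕ → ℕ → C) (i j : ℤ) : Cell C :=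
  if (0 ≤ i ∧ i < w) ∧ (0 ≤ j ∧ j < h) then
    framedCell w h i j (q i.toNat j.toNat)
  else .filler (q 0 0)

namespace IsFraming

open Cell

variable {C : Type} {H V : Set (Option C × Option C)} {x : ℤ → ℤ → Cell C}

theorem _root_.isFraming_framedRectangle {w h : ℕ} {q : ℕ → ℕ → C} (hq : IsTiled H V w h q) :
    IsFraming H V (framedRectangle w h q) := by
  refine ⟨fun i j => ?_, fun i j => ?_, fun i j => ?_⟩ <;> unfold framedRectangle
  · split_ifs with hij
    · obtain ⟨⟨h1, h2⟩, h3, h4⟩ := hij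
      refine ⟨?_, ?_, ?_, fun _ h5 => ?_, fun _ h5 => ?_, fun _ h5 => ?_, fun _ h5 => ?_⟩
      · simp only [framedCell]
        split_ifs <;> simp
      · simp only [framedCell]
        split_ifs <;> simp
      · simp only [framedCell]
        split_ifs <;> simp_all
      · obtain rfl : i = 0 := by simpa [framedCell] using h5
        exact hq.left _ (by omega)
      · have : i + 1 = w := by simpa [framedCell] using h5
        exact hq.right _ _ (by omega) (by omega)
      · obtain rfl : j = 0 := by simpa [framedCell] using h5
        exact hq.bottom _ (by omega)
      · have : j + 1 = h := by simpa [framedCell] using h5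
        exact hq.top _ _ (by omega) (by omega)
    · exact valid_filler _
  · split_ifs with h1 h2 h2
    · have e1 : i + 1 ≠ w := by omega
      have e2 : i + 1 ≠ 0 := by omega
      refine ⟨by simp [framedCell, e1, e2], fun _ => rfl, fun _ => rfl, fun _ => rfl, fun _ _ _ => ?_⟩
      have := hq.row i.toNat j.toNat (by omega) (by omega)
      rwa [show i.toNat + 1 = (i + 1).toNat by omega] at this
    · have e1 : i + 1 = w := by omega
      exact fitsH_of_ne (by simp [framedCell, e1]) (by simp [filler])
    · have e1 : i + 1 = 0 := by omega
      exact fitsH_of_ne (by simp [filler]) (by simp [framedCell, e1])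
    · exact fitsH_of_ne (by simp [filler]) (by simp [filler])
  · split_ifs with h1 h2 h2
    · have e1 : j + 1 ≠ h := by omega
      have e2 : j + 1 ≠ 0 := by omega
      refine ⟨by simp [framedCell, e1, e2], fun _ => rfl, fun _ => rfl, fun _ _ _ _ => ?_⟩
      have := hq.col i.toNat j.toNat (by omega) (by omega)
      rwa [show j.toNat + 1 = (j + 1).toNat by omega] at this
    · have e1 : j + 1 = h := by omega
      exact fitsV_of_ne (by simp [framedCell, e1]) (by simp [filler])
    · have e1 : j + 1 = 0 := by omega
      exact fitsV_of_ne (by simp [filler]) (by simp [framedCell, e1])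
    · exact fitsV_of_ne (by simp [filler]) (by simp [filler])

/-- A rectangle with a firm base of width `w` and of height at most `K + 1` contains a complete
picture of width `w`. -/
theorem exists_isTiled (hx : IsFraming H V x) {w K : ℕ} (hw : 0 < w)
    (hl : (x 0 0).left = .firm) (hr : ∀ i : ℕ, i + 1 = w → (x i 0).right = .firm)
    (hin : ∀ i : ℕ, i + 1 < w → (x i 0).right = .inner)
    (hb : ∀ i : ℕ, i < w → (x i 0).bottom = .firm) (htop : (x 0 K).top ≠ .inner) :
    ∃ g, 0 < g ∧ g ≤ K + 1 ∧ ∃ q, IsTiled H V w g q := by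
  classical
  have hex : ∃ j : ℕ, (x 0 j).top ≠ .inner := ⟨K, htop⟩
  set m := Nat.find hex with hm
  have hmK : m ≤ K := Nat.find_min' hex htop
  have hmtop : (x 0 m).top ≠ .inner := Nat.find_spec hex
  have hlt : ∀ j : ℕ, j < m → (x 0 j).top = .inner := fun j hj => by
    simpa using Nat.find_min hex hj
  have fitsH : ∀ i j : ℕ, (x i j).FitsH H (x (i + 1 : ℕ) j) := fun i j => by
    exact_mod_cast hx.fitsH i j
  have fitsV : ∀ i j : ℕ, (x i j).FitsV V (x i (j + 1 : ℕ)) := fun i j => by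
    exact_mod_cast hx.fitsV i j
  have row : ∀ j : ℕ, (∀ i : ℕ, i + 1 < w → (x i j).right = .inner) → ∀ i : ℕ, i < w →
      (x i j).top = (x 0 j).top ∧ (x i j).start = (x 0 j).start := by
    intro j hj i hi
    induction i with
    | zero => exact ⟨rfl, rfl⟩
    | succ i ih =>
      have h1 := fitsH i j
      have h2 := hj i hi
      rw [← h1.top h2, ← h1.start h2]
      exact ih (by omega)
  have hright : ∀ j : ℕ, j ≤ m → ∀ i : ℕ, i < w → (x i j).right = (x i 0).right ∧
      (x i j).left = (x i 0).left := by
    intro j hj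
    -- Inner right edges make the top label constant along row `j`; as it is inner below row `m`,
    -- all side labels pass to row `j + 1`.
    induction j with
    | zero => exact fun _ _ => ⟨rfl, rfl⟩
    | succ j ih =>
      intro i hi
      have ih := ih (by omega)
      have ht : (x i j).top = .inner := by
        rw [(row j (fun i hi => by rw [(ih i (by omega)).1, hin i hi]) i hi).1]
        exact hlt j (by omega)
      rw [← (fitsV i j).left ht, ← (fitsV i j).right ht]
      exact ih i hi
  have inner_right : ∀ i j : ℕ, i + 1 < w → j ≤ m → (x i j).right = .inner := fun i j hi hj => by
    rw [(hright j hj i (by omega)).1, hin i hi]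
  have top_eq : ∀ i j : ℕ, i < w → j ≤ m → (x i j).top = (x 0 j).top := fun i j hi hj =>
    (row j (fun i hi => inner_right i j hi hj) i hi).1
  have start_eq : ∀ i j : ℕ, i < w → j ≤ m → (x i j).start = (x 0 j).start := fun i j hi hj =>
    (row j (fun i hi => inner_right i j hi hj) i hi).2
  have left_firm : ∀ j : ℕ, j ≤ m → (x 0 j).left = .firm := fun j hj => by
    rw [← hl]
    exact_mod_cast (hright j hj 0 hw).2
  have right_firm : ∀ i j : ℕ, i + 1 = w → j ≤ m → (x i j).right = .firm := fun i j hi hj => by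
    rw [(hright j hj i (by omega)).1, hr i hi]
  -- A faulty top label spreads along the whole row and so reaches the side it blames, which is
  -- firm.
  have top_firm : (x 0 m).top = .firm := by
    obtain ⟨w, rfl⟩ : ∃ w', w = w' + 1 := ⟨w - 1, by omega⟩
    have h1 := (hx.valid 0 m).faultyLeft
    have h2 := (hx.valid w m).faultyRight
    rw [top_eq w m (by omega) le_rfl] at h2
    have h3 := left_firm m le_rfl
    have h4 := right_firm w m rfl le_rfl
    cases e : (x 0 m).top
    · exact absurd e hmtop
    · rfl
    · exact absurd h3 (h1 e)
    · exact absurd h4 (h2 e)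
  have not_faulty : ∀ i j : ℕ, i < w → j ≤ m → ¬ (x i j).Faulty := by
    intro i j hi hj
    have e1 : (x i j).left ≠ .faulty := by
      rcases i with - | i
      · simp [left_firm j hj]
      · rw [(fitsH i j).inner_iff.1 (inner_right i j hi hj)]
        simp
    have e2 : (x i j).right ≠ .faulty := by
      rcases Nat.lt_or_ge (i + 1) w with h | h
      · simp [inner_right i j h hj]
      · simp [right_firm i j (by omega) hj]
    have e3 : (x i j).bottom ≠ .faulty := by
      rcases j with - | j
      · simp [hb i hi]
      · rw [(fitsV i j).inner_iff.1 (by rw [top_eq i j hi (by omega), hlt j (by omega)])]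
        simp
    have e4 : (x i j).top = .inner ∨ (x i j).top = .firm := by
      rw [top_eq i j hi hj]
      rcases hj.lt_or_eq with h | rfl
      exacts [Or.inl (hlt j h), Or.inr top_firm]
    rcases e4 with e4 | e4 <;> simp [Faulty, e1, e2, e3, e4]
  -- Rows `s` to `m` hold the last picture begun: row `s` obeys the bottom rule, row `m` the top
  -- rule, and no restart lies between. The firm base ensures that row 0 is a candidate.
  set s := Nat.findGreatest (fun j : ℕ => (x 0 j).start = true) m with hs
  have hsm : s ≤ m := Nat.findGreatest_le m
  have start0 : (x 0 (0 : ℕ)).start = true := by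
    have := (hx.valid 0 0).firm_start (by exact_mod_cast hb 0 hw)
    exact_mod_cast this
  have hstart : (x 0 s).start = true :=
    Nat.findGreatest_spec (P := fun j : ℕ => (x 0 j).start = true) (Nat.zero_le m) start0
  have hnstart : ∀ j : ℕ, s < j → j ≤ m → (x 0 j).start = false := fun j h1 h2 => by
    simpa using Nat.findGreatest_is_greatest h1 h2
  refine ⟨m + 1 - s, by omega, by omega, fun i j => (x i (s + j : ℕ)).content,
    ⟨fun j hj => ?_, fun i j hi hj => ?_, fun i j hi hj => ?_, fun i hi => ?_,
      fun i j hi hj => ?_, fun i j hi hj => ?_⟩⟩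
  · exact (hx.valid _ _).left_content (not_faulty 0 _ hw (by omega)) (left_firm _ (by omega))
  · exact (hx.valid _ _).right_content (not_faulty i _ (by omega) (by omega))
      (right_firm i _ hi (by omega))
  · exact (fitsH i _).content (not_faulty i _ (by omega) (by omega))
      (not_faulty _ _ hi (by omega)) (inner_right i _ hi (by omega))
  · exact (hx.valid _ _).start_content (not_faulty i _ hi (by omega))
      ((start_eq i s hi hsm).trans hstart)
  · rw [show s + j = m by omega]
    exact (hx.valid _ _).top_content (not_faulty i _ hi le_rfl)
      ((top_eq i m hi le_rfl).trans top_firm)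
  · exact (fitsV i _).content (not_faulty i _ hi (by omega)) (not_faulty i _ hi (by omega))
      ((top_eq i _ hi (by omega)).trans (hlt _ (by omega)))
      ((start_eq i _ hi (by omega)).trans (hnstart _ (by omega) (by omega)))

end IsFraming

/-! ### The symmetric shift and its gluing functions -/

/-- Pairs of a framing and a transposed framing. -/
def symmetricFraming {C : Type} (H V : Set (Option C × Option C)) :
    Set (ℤ × ℤ → Cell C × Cell C) :=
  {y | IsFraming H V (fun i j => (y (i, j)).1) ∧ IsFraming H V (fun i j => (y (j, i)).2)}

section

variable {C : Type} {H V : Set (Option C × Option C)} [Fintype (Cell C × Cell C)]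
  [Inhabited (Cell C × Cell C)]

theorem isSFT_symmetricFraming : IsSFT (symmetricFraming H V) := by
  have key := isSFT_of_local ({(0, 0), (1, 0), (0, 1)} : Finset (ℤ × ℤ))
    (fun y : ℤ × ℤ → Cell C × Cell C =>
      (y (0, 0)).1.Valid H V ∧ (y (0, 0)).2.Valid H V ∧
      (y (0, 0)).1.FitsH H (y (1, 0)).1 ∧ (y (0, 0)).2.FitsH H (y (0, 1)).2 ∧
      (y (0, 0)).1.FitsV V (y (0, 1)).1 ∧ (y (0, 0)).2.FitsV V (y (1, 0)).2) ?_
  · convert key using 1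
    ext y
    simp only [Set.mem_ofPred_eq, symmetricFraming, Prod.forall, Prod.mk_add_mk, add_zero]
    constructor
    · rintro ⟨h1, h2⟩ i j
      exact ⟨h1.valid i j, h2.valid j i, h1.fitsH i j, h2.fitsH j i, h1.fitsV i j, h2.fitsV j i⟩
    · intro h
      exact ⟨⟨fun i j => (h i j).1, fun i j => (h i j).2.2.1, fun i j => (h i j).2.2.2.2.1⟩,
        ⟨fun i j => (h j i).2.1, fun i j => (h j i).2.2.2.1, fun i j => (h j i).2.2.2.2.2⟩⟩
  · intro x y hxy hx
    rw [← hxy (0, 0) (by simp), ← hxy (1, 0) (by simp), ← hxy (0, 1) (by simp)]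
    exact hx

/-- The layers do not interact, so they are glued separately, the second with the coordinates of `v`
exchanged. -/
theorem gluesAt_symmetricFraming {n F k : ℕ} (hF0 : 1 ≤ F)
    (hF : ∀ w : ℕ, 0 < w → w ≤ n → ∃ g, 0 < g ∧ g ≤ F ∧ ∃ q, IsTiled H V w g q)
    (hk : F + 2 ≤ k) {v : ℤ × ℤ} (hv : v = ((n : ℤ) + k, 0) ∨ v = (0, (n : ℤ) + k)) :
    GluesAt (symmetricFraming H V) n v := by
  rw [gluesAt_iff]
  rintro x ⟨hx₁, hx₂⟩ y ⟨hy₁, hy₂⟩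
  obtain ⟨z₁, h₁, e₁⟩ := hx₁.exists_glued hy₁ hF0 hF hk hv
  obtain ⟨z₂, h₂, e₂⟩ := hx₂.exists_glued hy₂ hF0 hF hk (v := (v.2, v.1))
    (by rcases hv with rfl | rfl <;> simp)
  refine ⟨fun u => (z₁ u.1 u.2, z₂ u.2 u.1), ⟨h₁, h₂⟩, ?_⟩
  rintro ⟨i, j⟩ hu
  obtain ⟨⟨h1, h2⟩, h3, h4⟩ := mem_square.1 hu
  have a₁ := e₁ i j h1 h2 h3 h4
  have a₂ := e₂ j i h3 h4 h1 h2
  exact ⟨Prod.ext a₁.1 a₂.1, Prod.ext a₁.2 a₂.2⟩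

/-- A complete picture of width `n` above a firm base obstructs gluing at small distances. -/
theorem IsFraming.not_inner_of_glued {C : Type} {H V : Set (Option C × Option C)}
    {z : ℤ → ℤ → Cell C} (hz : IsFraming H V z) {n h k : ℕ} (hn : 0 < n) (hh : 0 < h)
    {q : ℕ → ℕ → C}
    (h₁ : ∀ i j : ℤ, 0 ≤ i → i < n → 0 ≤ j → j < n →
      z i j = framedRectangle n h q i (j + -((n : ℤ) - 1)))
    (h₂ : (z 0 ((n : ℤ) + k)).bottom ≠ .inner) :
    ∃ g, 0 < g ∧ g ≤ k + 1 ∧ ∃ q, IsTiled H V n g q := by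
  have base : ∀ i : ℕ, i < n → z i ((n : ℤ) - 1) = framedRectangle n h q i 0 := fun i hi => by
    rw [h₁ _ _ (by omega) (by omega) (by omega) (by omega), add_neg_cancel]
  have value : ∀ i : ℕ, i < n → z i ((n : ℤ) - 1) =
      ⟨if i = 0 then .firm else .inner, if i + 1 = n then .firm else .inner, .firm,
        if 1 = h then .firm else .inner, true, q i 0⟩ := fun i hi => by
    rw [base i hi, framedRectangle, if_pos (by omega)]
    exact Cell.ext (if_congr (by omega) rfl rfl) (if_congr (by omega) rfl rfl) rfl
      (if_congr (by omega) rfl rfl) rfl rfl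
  -- After the shift the base is row 0, and the edge between rows `k` and `k + 1` is the lower edge
  -- of the second block.
  refine (hz.shift 0 ((n : ℤ) - 1)).exists_isTiled (K := k) hn ?_ (fun i hi => ?_)
    (fun i hi => ?_) (fun i hi => ?_) fun h3 => h₂ ?_
  · have := value 0 hn
    simp only [Nat.cast_zero] at this
    simp [this]
  · simp [value i (by omega), hi]
  · simp [value i (by omega), hi.ne]
  · simp [value i hi]
  · have := (hz.fitsV 0 (k + (n - 1))).inner_iff.1 (by simpa using h3)
    rwa [show (k : ℤ) + (n - 1) + 1 = n + k by ring] at this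

/-- The first pattern shows a firm base in its top row (first layer) and in its right column (second
layer); the second pattern is all fillers, which no rectangle can enter. The first layer obstructs
vertical gluing, the second horizontal gluing. -/
theorem exists_isTiled_of_gluesAt {n h k : ℕ} (hn : 0 < n) (hh : 0 < h)
    {q : ℕ → ℕ → C} (hq : IsTiled H V n h q) {v : ℤ × ℤ}
    (hv : v = ((n : ℤ) + k, 0) ∨ v = (0, (n : ℤ) + k))
    (hg : GluesAt (symmetricFraming H V) n v) :
    ∃ g, 0 < g ∧ g ≤ k + 1 ∧ ∃ q, IsTiled H V n g q := by
  -- The shift by `n - 1` leaves only the base row of the rectangle inside the square, so its height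
  -- is not fixed by the pattern.
  have hR := (isFraming_framedRectangle hq).shift 0 (-((n : ℤ) - 1))
  have hfill := IsFraming.const_filler (H := H) (V := V) (q 0 0)
  rw [gluesAt_iff] at hg
  obtain ⟨z, ⟨hz₁, hz₂⟩, hz⟩ := hg
    (fun u => (framedRectangle n h q (u.1 + 0) (u.2 + -((n : ℤ) - 1)),
      framedRectangle n h q (u.2 + 0) (u.1 + -((n : ℤ) - 1)))) ⟨hR, hR⟩
    (fun _ => (.filler (q 0 0), .filler (q 0 0))) ⟨hfill, hfill⟩
  have h0 := (hz (0, 0) (mem_square.2 (by omega))).2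
  rcases hv with rfl | rfl
  · refine hz₂.not_inner_of_glued hn hh (q := q) (fun i j h1 h2 h3 h4 => ?_) ?_
    · have := (hz (j, i) (mem_square.2 ⟨⟨h3, h4⟩, h1, h2⟩)).1
      simpa using congrArg Prod.snd this
    · simp only [Prod.mk_add_mk, add_zero] at h0
      simp [h0, Cell.filler]
  · refine hz₁.not_inner_of_glued hn hh (q := q) (fun i j h1 h2 h3 h4 => ?_) ?_
    · have := (hz (i, j) (mem_square.2 ⟨⟨h1, h2⟩, h3, h4⟩)).1
      simpa using congrArg Prod.fst this
    · simp only [Prod.mk_add_mk, add_zero] at h0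
      simp [h0, Cell.filler]

end

/-! ### The main theorem -/

theorem exists_sft_of_tendsto {f : ℕ+ → ℕ+} (hmono : Monotone f)
    (hf : Filter.Tendsto (fun n => (f n : ℕ)) Filter.atTop Filter.atTop)
    (hrec : IsRecognizableShapeSet (epigraph f)) :
    ∃ (A : Type) (_ : Fintype A) (_ : Inhabited A) (X : Set (ℤ × ℤ → A)),
      IsSFT X ∧
      AsympEq (fun n => blockGluing X n) (fun n => blockGluingV X n) ∧
      AsympEq (fun n => blockGluingV X n) (fun n => blockGluingH X n) ∧
      AsympEq (fun n => blockGluingH X n) (fun n => ((f n : ℕ) : ℕ∞)) := by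
  obtain ⟨C, hC, ⟨s⟩, H, V, htile⟩ := hrec.exists_isTiled_iff ⟨(1, f 1), le_refl (f 1)⟩
  let _ : Fintype (Cell C × Cell C) := Fintype.ofFinite _
  let _ : Inhabited (Cell C × Cell C) := ⟨(.filler s, .filler s)⟩
  -- The shape `(w, f w)` is in the epigraph, and monotonicity gives `f w ≤ f n`.
  have hF : ∀ n : ℕ+, ∀ w : ℕ, 0 < w → w ≤ n →
      ∃ g, 0 < g ∧ g ≤ (f n : ℕ) ∧ ∃ q, IsTiled H V w g q := fun n w h1 h2 =>
    ⟨f ⟨w, h1⟩, (f _).pos, hmono (show (⟨w, h1⟩ : ℕ+) ≤ n from h2),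
      (htile ⟨w, h1⟩ _).2 (le_refl (f ⟨w, h1⟩))⟩
  have upper : ∀ (n : ℕ+) (v : ℤ × ℤ),
      v = (((n : ℕ) : ℤ) + (f n + 2 : ℕ), 0) ∨ v = (0, ((n : ℕ) : ℤ) + (f n + 2 : ℕ)) →
      GluesAt (symmetricFraming H V) n v :=
    fun n v hv => gluesAt_symmetricFraming (f n).pos (hF n) le_rfl hv
  have lower : ∀ (n : ℕ+) (k : ℕ) (v : ℤ × ℤ),
      v = (((n : ℕ) : ℤ) + k, 0) ∨ v = (0, ((n : ℕ) : ℤ) + k) →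
      GluesAt (symmetricFraming H V) n v → (f n : ℕ) ≤ k + 2 := by
    intro n k v hv hg
    obtain ⟨q, hq⟩ := (htile n (f n)).2 (le_refl (f n))
    obtain ⟨g, h1, h2, hq'⟩ := exists_isTiled_of_gluesAt n.pos (f n).pos hq hv hg
    have h3 : f n ≤ ⟨g, h1⟩ := (htile n ⟨g, h1⟩).1 hq'
    have h4 : (f n : ℕ) ≤ g := h3
    omega
  have hH' : ∀ n : ℕ+, blockGluingH (symmetricFraming H V) n ≤ (f n : ℕ) + (2 : ℕ) := fun n => by
    exact_mod_cast iInf₂_le (f n + 2 : ℕ) (upper n _ (Or.inl rfl))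
  have hV' : ∀ n : ℕ+, blockGluingV (symmetricFraming H V) n ≤ (f n : ℕ) + (2 : ℕ) := fun n => by
    exact_mod_cast iInf₂_le (f n + 2 : ℕ) (upper n _ (Or.inr rfl))
  have le_of : ∀ {a k : ℕ}, a ≤ k + 2 → ((a - 2 : ℕ) : ℕ∞) ≤ k := fun h => by
    exact_mod_cast Nat.sub_le_of_le_add h
  have le_add : ∀ (a : ℕ) {u : ℕ∞}, ((a - 2 : ℕ) : ℕ∞) ≤ u → (a : ℕ∞) ≤ u + (2 : ℕ) :=
    fun a u h => le_trans (by exact_mod_cast (by omega : a ≤ a - 2 + 2)) (add_le_add_left h _)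
  have hH : ∀ n : ℕ+, ((f n : ℕ) : ℕ∞) ≤ blockGluingH (symmetricFraming H V) n + (2 : ℕ) :=
    fun n => le_add _ (le_iInf₂ fun k hk => le_of (lower n k _ (Or.inl rfl) hk))
  have hV : ∀ n : ℕ+, ((f n : ℕ) : ℕ∞) ≤ blockGluingV (symmetricFraming H V) n + (2 : ℕ) :=
    fun n => le_add _ (le_iInf₂ fun k hk => le_of (lower n k _ (Or.inr rfl) hk))
  refine ⟨_, inferInstance, inferInstance, symmetricFraming H V, isSFT_symmetricFraming, ?_, ?_, ?_⟩
  · refine asympEq_of_bounded_distance 2 hf (fun n => (hH n).trans ?_)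
      (fun n => max_le (hH' n) (hV' n)) hV hV'
    exact add_le_add_left (le_max_left _ _) _
  · exact asympEq_of_bounded_distance 2 hf hV hV' hH hH'
  · exact asympEq_of_bounded_distance 2 hf hH hH' (fun n => le_self_add) (fun n => le_self_add)

theorem Monotone.tendsto_or_eventually_const {f : ℕ+ → ℕ+} (hf : Monotone f) :
    Filter.Tendsto (fun n => (f n : ℕ)) Filter.atTop Filter.atTop ∨
      ∃ c, ∀ᶠ n in Filter.atTop, f n = c := by
  by_cases h : ∀ b : ℕ, ∃ n, b ≤ (f n : ℕ)
  · exact Or.inl (Filter.tendsto_atTop_atTop_of_monotone (fun a b hab => hf hab) h)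
  · push Not at h
    obtain ⟨b, hb⟩ := h
    have hfin : (Set.range fun n => (f n : ℕ)).Finite :=
      (Set.finite_Iio b).subset (Set.range_subset_iff.2 fun n => hb n)
    obtain ⟨_, ⟨N, rfl⟩, hN⟩ := hfin.exists_maximal ⟨_, Set.mem_range_self 1⟩
    refine Or.inr ⟨f N, Filter.eventually_atTop.2 ⟨N, fun n hn => ?_⟩⟩
    exact le_antisymm (hN (Set.mem_range_self n) (hf hn)) (hf hn)

theorem mainTheorem2 (f : ℕ+ → ℕ+) (hmono : Monotone f)
    (hrec : IsRecognizableShapeSet (epigraph f)) :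
    ∃ (A : Type) (_ : Fintype A) (_ : Inhabited A) (X : Set (ℤ × ℤ → A)),
      IsSFT X ∧
      AsympEq (fun n => blockGluing X n) (fun n => blockGluingV X n) ∧
      AsympEq (fun n => blockGluingV X n) (fun n => blockGluingH X n) ∧
      AsympEq (fun n => blockGluingH X n) (fun n => ((f n : ℕ) : ℕ∞)) := by
  rcases hmono.tendsto_or_eventually_const with hf | ⟨c, hc⟩
  · exact exists_sft_of_tendsto hmono hf hrec
  · exact exists_sft_of_eventually_const hc
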